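/- Let $n\ge 0$ and let $X_1,\dots,X_n$ be independent random variables taking the values $0$ or $1$, with $\Pr(X_i=1)=p_i$ and $\Pr(X_i=0)=1-p_i$, where $0\le p_i\le 1$ for $i=1,\dots,n$. Write $H(Z)=-\sum_z \Pr(Z=z)\log_2\Pr(Z=z)$ (with $0\log_2 0=0$) for the Shannon entropy of a discrete random variable $Z$, and let $$H_n(p)=-\sum_{k=0}^{n}\binom nk p^k(1-p)^{n-k}\,\log_2\!\left(\binom nk p^k(1-p)^{n-k}\right)$$ be the Shannon entropy of the binomial distribution with $n$ trials and success probability $p$. Then the Shannon entropy of $X_1+X_2+\cdots+X_n$ is maximal when $p_i=1/2$ for all $i=1,\dots,n$, and its value there is $H_n(1/2)$; that is, $$\max_{0\le p_1,\dots,p_n\le 1} H\Big(\sum_{i=1}^n X_i\Big)=H_n(1/2).$$ -/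

import Mathlib

open MeasureTheory ProbabilityTheory

/-- The Shannon entropy, in bits, of a discrete random variable `Z` under the law `μ`:
`-∑ Pr(Z = z) log₂ Pr(Z = z)`, with `0 log 0 = 0`. -/
noncomputable def shannonEntropy {Ω S : Type*} [MeasurableSpace Ω] (μ : Measure Ω)
    (Z : Ω → S) : ℝ :=
  -∑' z : S, μ.real (Z ⁻¹' {z}) * Real.logb 2 (μ.real (Z ⁻¹' {z}))

/-- The Shannon entropy `H_n(p)`, in bits, of the binomial distribution with `n` independent
trials and success probability `p`. -/
noncomputable def binomialEntropy (n : ℕ) (p : ℝ) : ℝ :=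
  -∑ k ∈ Finset.range (n + 1),
    ((n.choose k : ℝ) * p ^ k * (1 - p) ^ (n - k)) *
      Real.logb 2 ((n.choose k : ℝ) * p ^ k * (1 - p) ^ (n - k))

/-- `X₁, …, Xₙ` are independent random variables with `Pr(Xᵢ = 1) = pᵢ` and
`Pr(Xᵢ = 0) = 1 - pᵢ`. -/
structure IsIndepBernoulli {Ω : Type*} [MeasurableSpace Ω] (μ : Measure Ω) {n : ℕ}
    (X : Fin n → Ω → ℕ) (p : Fin n → ℝ) : Prop where
  measurable : ∀ i, Measurable (X i)
  indep : iIndepFun X μ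
  prob_one : ∀ i, μ.real (X i ⁻¹' {1}) = p i
  prob_zero : ∀ i, μ.real (X i ⁻¹' {0}) = 1 - p i

/-! The law of the sum is the coefficient sequence of `∏ (1 + pᵢ(X - 1))`, so the problem concerns
entropies of such polynomials.

Averaging: replacing two parameters by their mean turns the product `P` into `P'` with `P = P' -
d²(X - 1)²Q`, where `d` is half their difference and `Q` is the product over the other indices. The
tangent bound for `-t log t` and two summations by parts bound the entropy of `P` minus that of `P'`
by `d² ∑ Qₖ Δ²(log P')ₖ`. This is nonpositive because `P'` is log-concave. Compactness then reduces
the problem to equal parameters (`exists_coeffEntropy_le_pow`).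

Binomial case: in nats, the entropy is `n h(x) - E log (n choose K)`, with `h` the binary entropy.
Differentiating a binomial mean takes a finite difference inside it, and bounds on the second
difference of `log (n choose k)` make the entropy concave (`concaveOn_coeffEntropy_pow`). Symmetry
under `x ↦ 1 - x` puts the maximum at `1/2`. -/

open Polynomial in
/-- The probability generating polynomial of a Bernoulli variable with parameter `x`. -/
noncomputable def bernoulliPoly (x : ℝ) : Polynomial ℝ := 1 + C x * (X - 1)

/-- The entropy, in nats, of the first `n + 1` coefficients of a polynomial. -/
noncomputable def coeffEntropy (n : ℕ) (P : Polynomial ℝ) : ℝ :=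
  ∑ k ∈ Finset.range (n + 1), Real.negMulLog (P.coeff k)

lemma coeff_mul_bernoulliPoly_zero (Q : Polynomial ℝ) (x : ℝ) :
    (Q * bernoulliPoly x).coeff 0 = (1 - x) * Q.coeff 0 := by
  simp [bernoulliPoly, Polynomial.mul_coeff_zero]; ring

lemma coeff_mul_bernoulliPoly_succ (Q : Polynomial ℝ) (x : ℝ) (k : ℕ) :
    (Q * bernoulliPoly x).coeff (k + 1) = (1 - x) * Q.coeff (k + 1) + x * Q.coeff k := by
  have : Q * bernoulliPoly x
      = Q + Polynomial.C x * (Q * Polynomial.X) - Polynomial.C x * Q := by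
    simp only [bernoulliPoly]; ring
  rw [this]
  simp only [Polynomial.coeff_add, Polynomial.coeff_sub, Polynomial.coeff_C_mul,
    Polynomial.coeff_mul_X]
  ring

/-- A difference of squares in `X - 1`: at fixed mean, spreading two parameters subtracts a
second-difference operator. -/
lemma bernoulliPoly_mul_bernoulliPoly (u d : ℝ) :
    bernoulliPoly (u + d) * bernoulliPoly (u - d) =
      bernoulliPoly u * bernoulliPoly u
        - Polynomial.C (d ^ 2) * ((Polynomial.X - 1) * (Polynomial.X - 1)) := by
  simp only [bernoulliPoly, map_add, map_sub, map_pow]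
  ring

/-! ### Coefficients of Bernoulli products: positivity, support, log-concavity, continuity -/

section BernoulliProducts

variable {ι : Type*}

lemma coeff_prod_bernoulliPoly_nonneg (s : Finset ι) (p : ι → ℝ)
    (hp : ∀ i ∈ s, p i ∈ Set.Icc (0 : ℝ) 1) (k : ℕ) :
    0 ≤ (∏ i ∈ s, bernoulliPoly (p i)).coeff k := by
  classical
  induction s using Finset.induction_on generalizing k with
  | empty => simp only [Finset.prod_empty, Polynomial.coeff_one]; split_ifs <;> simp
  | insert a s ha ih =>
    have ih := ih (fun i hi => hp i (Finset.mem_insert_of_mem hi))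
    obtain ⟨h0, h1⟩ := hp a (Finset.mem_insert_self a s)
    rw [Finset.prod_insert ha, mul_comm]
    cases k with
    | zero =>
      rw [coeff_mul_bernoulliPoly_zero]
      exact mul_nonneg (by linarith) (ih 0)
    | succ k =>
      rw [coeff_mul_bernoulliPoly_succ]
      exact add_nonneg (mul_nonneg (by linarith) (ih _)) (mul_nonneg h0 (ih _))

lemma coeff_prod_bernoulliPoly_eq_zero (s : Finset ι) (p : ι → ℝ) {k : ℕ} (hk : s.card < k) :
    (∏ i ∈ s, bernoulliPoly (p i)).coeff k = 0 := by
  classical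
  induction s using Finset.induction_on generalizing k with
  | empty =>
    have : k ≠ 0 := by rintro rfl; simp at hk
    simp [Polynomial.coeff_one, this]
  | insert a s ha ih =>
    rw [Finset.card_insert_of_notMem ha] at hk
    rw [Finset.prod_insert ha, mul_comm]
    obtain ⟨k, rfl⟩ : ∃ j, k = j + 1 := ⟨k - 1, by omega⟩
    rw [coeff_mul_bernoulliPoly_succ, ih (by omega), ih (by omega)]
    simp

lemma coeff_prod_bernoulliPoly_pos (s : Finset ι) (p : ι → ℝ)
    (hp : ∀ i ∈ s, p i ∈ Set.Ioo (0 : ℝ) 1) {k : ℕ} (hk : k ≤ s.card) :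
    0 < (∏ i ∈ s, bernoulliPoly (p i)).coeff k := by
  classical
  induction s using Finset.induction_on generalizing k with
  | empty =>
    have : k = 0 := by simpa using hk
    simp [this]
  | insert a s ha ih =>
    have hps : ∀ i ∈ s, p i ∈ Set.Ioo (0 : ℝ) 1 :=
      fun i hi => hp i (Finset.mem_insert_of_mem hi)
    obtain ⟨h0, h1⟩ := hp a (Finset.mem_insert_self a s)
    rw [Finset.card_insert_of_notMem ha] at hk
    rw [Finset.prod_insert ha, mul_comm]
    cases k with
    | zero =>
      rw [coeff_mul_bernoulliPoly_zero]
      exact mul_pos (by linarith) (ih hps (by omega))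
    | succ k =>
      rw [coeff_mul_bernoulliPoly_succ]
      refine add_pos_of_nonneg_of_pos (mul_nonneg (by linarith) ?_)
        (mul_pos h0 (ih hps (by omega)))
      exact coeff_prod_bernoulliPoly_nonneg s p (fun i hi => Set.Ioo_subset_Icc_self (hps i hi)) _

/-- Log-concavity without internal zeros. -/
lemma coeff_prod_bernoulliPoly_mul_le (s : Finset ι) (p : ι → ℝ)
    (hp : ∀ i ∈ s, p i ∈ Set.Icc (0 : ℝ) 1) {i j : ℕ} (hij : i ≤ j) (d : ℕ) :
    (∏ i ∈ s, bernoulliPoly (p i)).coeff i * (∏ i ∈ s, bernoulliPoly (p i)).coeff (j + d) ≤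
      (∏ i ∈ s, bernoulliPoly (p i)).coeff (i + d) * (∏ i ∈ s, bernoulliPoly (p i)).coeff j := by
  classical
  induction s using Finset.induction_on generalizing i j d with
  | empty =>
    simp only [Finset.prod_empty, Polynomial.coeff_one]
    split_ifs <;> first | omega | simp
  | insert a s ha ih =>
    have hps : ∀ i ∈ s, p i ∈ Set.Icc (0 : ℝ) 1 :=
      fun i hi => hp i (Finset.mem_insert_of_mem hi)
    have ih := @ih hps
    have hnn := coeff_prod_bernoulliPoly_nonneg s p hps
    obtain ⟨h0, h1⟩ := hp a (Finset.mem_insert_self a s)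
    rw [Finset.prod_insert ha, mul_comm (bernoulliPoly (p a))]
    generalize (∏ i ∈ s, bernoulliPoly (p i)) = Q at *
    generalize p a = x at *
    have hx : 0 ≤ 1 - x := by linarith
    have hxx : 0 ≤ x * (1 - x) := mul_nonneg h0 hx
    rcases d with _ | d
    · simp
    rcases j with _ | j
    · obtain rfl : i = 0 := by omega
      rw [mul_comm]
    rcases i with _ | i
    · rw [show j + 1 + (d + 1) = (j + d + 1) + 1 by ring, show 0 + (d + 1) = d + 1 by ring]
      simp only [coeff_mul_bernoulliPoly_zero, coeff_mul_bernoulliPoly_succ]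
      have e1 := @ih 0 (j + 1) (by omega) (d + 1)
      have e2 := @ih 0 (j + 1) (by omega) d
      rw [show j + 1 + (d + 1) = (j + d + 1) + 1 by ring, show 0 + (d + 1) = d + 1 by ring] at e1
      rw [show j + 1 + d = (j + d + 1) by ring, show 0 + d = d by ring] at e2
      have f1 := mul_le_mul_of_nonneg_left e1 (mul_nonneg hx hx)
      have f2 := mul_le_mul_of_nonneg_left e2 hxx
      have f3 := mul_nonneg hxx (mul_nonneg (hnn (d + 1)) (hnn j))
      have f4 := mul_nonneg (mul_nonneg h0 h0) (mul_nonneg (hnn d) (hnn j))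
      nlinarith [f1, f2, f3, f4]
    · rw [show j + 1 + (d + 1) = (j + d + 1) + 1 by ring,
        show i + 1 + (d + 1) = (i + d + 1) + 1 by ring]
      simp only [coeff_mul_bernoulliPoly_succ]
      -- Compare the coefficients of `(1 - x)²`, `x²` and `x(1 - x)`: they follow from `e1`, `e3`
      -- and `e2 + e4`. The larger gap in `e4` is why the induction runs over all gaps and not only
      -- adjacent coefficients.
      have e1 := @ih (i + 1) (j + 1) (by omega) (d + 1)
      have e2 := @ih (i + 1) (j + 1) (by omega) d
      have e3 := @ih i j (by omega) (d + 1)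
      have e4 := @ih i j (by omega) (d + 2)
      rw [show j + 1 + (d + 1) = (j + d + 1) + 1 by ring,
        show i + 1 + (d + 1) = (i + d + 1) + 1 by ring] at e1
      rw [show j + 1 + d = (j + d + 1) by ring, show i + 1 + d = i + d + 1 by ring] at e2
      rw [show j + (d + 1) = (j + d + 1) by ring, show i + (d + 1) = i + d + 1 by ring] at e3
      rw [show j + (d + 2) = (j + d + 1) + 1 by ring,
        show i + (d + 2) = i + d + 1 + 1 by ring] at e4
      have f1 := mul_le_mul_of_nonneg_left e1 (mul_nonneg hx hx)
      have f2 := mul_le_mul_of_nonneg_left e2 hxx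
      have f3 := mul_le_mul_of_nonneg_left e3 (mul_nonneg h0 h0)
      have f4 := mul_le_mul_of_nonneg_left e4 hxx
      linarith [f1, f2, f3, f4]

lemma continuous_coeff_prod_bernoulliPoly (s : Finset ι) (k : ℕ) :
    Continuous fun p : ι → ℝ => (∏ i ∈ s, bernoulliPoly (p i)).coeff k := by
  classical
  induction s using Finset.induction_on generalizing k with
  | empty => simpa using continuous_const
  | insert a s ha ih =>
    simp_rw [Finset.prod_insert ha, mul_comm (bernoulliPoly _)]
    cases k with
    | zero =>
      simp_rw [coeff_mul_bernoulliPoly_zero]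
      exact (continuous_const.sub (continuous_apply a)).mul (ih 0)
    | succ k =>
      simp_rw [coeff_mul_bernoulliPoly_succ]
      exact ((continuous_const.sub (continuous_apply a)).mul (ih _)).add
        ((continuous_apply a).mul (ih _))

lemma continuous_coeffEntropy_prod (n : ℕ) (s : Finset ι) :
    Continuous fun p : ι → ℝ => coeffEntropy n (∏ i ∈ s, bernoulliPoly (p i)) :=
  continuous_finsetSum _ fun k _ =>
    Real.continuous_negMulLog.comp (continuous_coeff_prod_bernoulliPoly s k)

end BernoulliProducts

/-! ### Averaging two parameters, and reduction to the binomial -/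

/-- Summation by parts against the coefficients of a polynomial. -/
lemma sum_coeff_X_sub_one_mul (Q : Polynomial ℝ) (L : ℕ → ℝ) {N : ℕ} (hQ : Q.coeff N = 0) :
    ∑ k ∈ Finset.range (N + 1), ((Polynomial.X - 1) * Q).coeff k * L k =
      ∑ k ∈ Finset.range N, Q.coeff k * (L (k + 1) - L k) := by
  have h : ∀ k, ((Polynomial.X - 1) * Q).coeff k * L k
      = (Polynomial.X * Q).coeff k * L k - Q.coeff k * L k := by
    intro k; rw [sub_mul, one_mul, Polynomial.coeff_sub, sub_mul]
  simp_rw [h, Finset.sum_sub_distrib, mul_sub, Finset.sum_sub_distrib]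
  rw [Finset.sum_range_succ', Finset.sum_range_succ (fun k => Q.coeff k * L k), hQ]
  simp [Polynomial.coeff_X_mul]

lemma negMulLog_le_tangent {x y : ℝ} (hx : 0 ≤ x) (hy : 0 < y) :
    Real.negMulLog x ≤ Real.negMulLog y - (Real.log y + 1) * (x - y) := by
  rcases hx.eq_or_lt with rfl | hx
  · simp only [Real.negMulLog]; simp; linarith
  · have h := Real.log_le_sub_one_of_pos (div_pos hy hx)
    rw [Real.log_div hy.ne' hx.ne'] at h
    have h2 := mul_le_mul_of_nonneg_left h hx.le
    have h3 : x * (y / x - 1) = y - x := by field_simp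
    simp only [Real.negMulLog]
    nlinarith

/-- Moving the coefficients along a second difference decreases the entropy. -/
lemma coeffEntropy_sub_le {m : ℕ} {P Q : Polynomial ℝ} {c : ℝ} (hc : 0 ≤ c)
    (hQ : ∀ k, 0 ≤ Q.coeff k) (hQm : ∀ k, m < k → Q.coeff k = 0)
    (hP : ∀ k ≤ m + 2, 0 < P.coeff k)
    (hlc : ∀ k, P.coeff k * P.coeff (k + 2) ≤ P.coeff (k + 1) * P.coeff (k + 1))
    (hR : ∀ k, 0 ≤ (P - Polynomial.C c * ((Polynomial.X - 1) * ((Polynomial.X - 1) * Q))).coeff k) :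
    coeffEntropy (m + 2) (P - Polynomial.C c * ((Polynomial.X - 1) * ((Polynomial.X - 1) * Q))) ≤
      coeffEntropy (m + 2) P := by
  set D := (Polynomial.X - 1) * ((Polynomial.X - 1) * Q) with hD
  -- Two summations by parts; `Q` vanishes beyond `m`, so no boundary terms remain.
  have key : ∀ L : ℕ → ℝ, ∑ k ∈ Finset.range (m + 3), D.coeff k * L k =
      ∑ k ∈ Finset.range (m + 1), Q.coeff k * (L (k + 2) - L (k + 1) - (L (k + 1) - L k)) := by
    intro L
    rw [hD, sum_coeff_X_sub_one_mul, sum_coeff_X_sub_one_mul]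
    · exact hQm _ (by omega)
    · rw [sub_mul, one_mul, Polynomial.coeff_sub, Polynomial.coeff_X_mul, hQm _ (by omega),
        hQm _ (by omega), sub_zero]
  -- The second difference kills the constant `1`, and log-concavity makes that of `log P`
  -- nonpositive.
  have hneg : ∑ k ∈ Finset.range (m + 3), D.coeff k * (Real.log (P.coeff k) + 1) ≤ 0 := by
    rw [key]
    refine Finset.sum_nonpos fun k hk => mul_nonpos_of_nonneg_of_nonpos (hQ k) ?_
    rw [Finset.mem_range] at hk
    have h0 := hP k (by omega)
    have h1 := hP (k + 1) (by omega)
    have h2 := hP (k + 2) (by omega)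
    have h := Real.log_le_log (mul_pos h0 h2) (hlc k)
    rw [Real.log_mul h0.ne' h2.ne', Real.log_mul h1.ne' h1.ne'] at h
    linarith
  calc coeffEntropy (m + 2) (P - Polynomial.C c * D)
      ≤ ∑ k ∈ Finset.range (m + 2 + 1), (Real.negMulLog (P.coeff k)
          + c * (D.coeff k * (Real.log (P.coeff k) + 1))) := by
        refine Finset.sum_le_sum fun k hk => ?_
        rw [Finset.mem_range] at hk
        refine (negMulLog_le_tangent (hR k) (hP k (by omega))).trans_eq ?_
        rw [Polynomial.coeff_sub, Polynomial.coeff_C_mul]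
        ring
    _ ≤ coeffEntropy (m + 2) P := by
        rw [Finset.sum_add_distrib, ← Finset.mul_sum]
        have := mul_nonpos_of_nonneg_of_nonpos hc hneg
        simp only [coeffEntropy]
        linarith

/-- Replace the entries `i` and `j` of a vector by their mean. -/
noncomputable def averagePair {n : ℕ} (p : Fin n → ℝ) (i j : Fin n) : Fin n → ℝ :=
  Function.update (Function.update p i ((p i + p j) / 2)) j ((p i + p j) / 2)

lemma averagePair_mem {n : ℕ} {p : Fin n → ℝ} {S : Set ℝ} (hS : Convex ℝ S)
    (hp : ∀ k, p k ∈ S) (i j k : Fin n) : averagePair p i j k ∈ S := by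
  have h : (p i + p j) / 2 ∈ S := by
    have := hS (hp i) (hp j) (a := 1 / 2) (b := 1 / 2) (by norm_num) (by norm_num) (by norm_num)
    simp only [smul_eq_mul] at this
    convert this using 1
    ring
  simp only [averagePair, Function.update_apply]
  split_ifs <;> simp [h, hp]

lemma prod_eq_mul_mul_prod_compl {M : Type*} [CommMonoid M] {n : ℕ} (f : Fin n → M) {i j : Fin n}
    (hij : i ≠ j) : ∏ k, f k = f i * f j * ∏ k ∈ ({i, j} : Finset (Fin n))ᶜ, f k := by
  rw [← Finset.prod_mul_prod_compl {i, j} f, Finset.prod_pair hij]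

lemma coeffEntropy_le_averagePair_of_mem_Ioo {n : ℕ} {p : Fin n → ℝ}
    (hp : ∀ k, p k ∈ Set.Ioo (0 : ℝ) 1) {i j : Fin n} (hij : i ≠ j) :
    coeffEntropy n (∏ k, bernoulliPoly (p k)) ≤
      coeffEntropy n (∏ k, bernoulliPoly (averagePair p i j k)) := by
  set p' := averagePair p i j with hp'
  have hp'mem : ∀ k, p' k ∈ Set.Ioo (0 : ℝ) 1 := averagePair_mem (convex_Ioo 0 1) hp i j
  have hi : p' i = (p i + p j) / 2 := by simp [hp', averagePair, hij]
  have hj : p' j = (p i + p j) / 2 := by simp [hp', averagePair]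
  set Q := ∏ k ∈ ({i, j} : Finset (Fin n))ᶜ, bernoulliPoly (p k) with hQ
  have hcard : ({i, j} : Finset (Fin n))ᶜ.card + 2 = n := by
    have := Finset.card_add_card_compl ({i, j} : Finset (Fin n))
    rw [Finset.card_pair hij, Fintype.card_fin] at this
    omega
  have hQ' : ∏ k ∈ ({i, j} : Finset (Fin n))ᶜ, bernoulliPoly (p' k) = Q := by
    refine Finset.prod_congr rfl fun k hk => ?_
    simp only [Finset.mem_compl, Finset.mem_insert, Finset.mem_singleton, not_or] at hk
    simp [hp', averagePair, hk.1, hk.2]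
  have hP : ∏ k, bernoulliPoly (p k) = ∏ k, bernoulliPoly (p' k)
      - Polynomial.C (((p i - p j) / 2) ^ 2)
        * ((Polynomial.X - 1) * ((Polynomial.X - 1) * Q)) := by
    rw [prod_eq_mul_mul_prod_compl _ hij, prod_eq_mul_mul_prod_compl _ hij, hQ', hi, hj]
    have h := bernoulliPoly_mul_bernoulliPoly ((p i + p j) / 2) ((p i - p j) / 2)
    rw [show (p i + p j) / 2 + (p i - p j) / 2 = p i by ring,
      show (p i + p j) / 2 - (p i - p j) / 2 = p j by ring] at h
    rw [h]
    ring
  have hR := coeff_prod_bernoulliPoly_nonneg Finset.univ p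
    fun k _ => Set.Ioo_subset_Icc_self (hp k)
  rw [hP] at hR ⊢
  have hmain := coeffEntropy_sub_le (m := ({i, j} : Finset (Fin n))ᶜ.card) (sq_nonneg _)
    (coeff_prod_bernoulliPoly_nonneg _ p fun k _ => Set.Ioo_subset_Icc_self (hp k))
    (fun k hk => coeff_prod_bernoulliPoly_eq_zero _ p hk)
    (fun k hk => coeff_prod_bernoulliPoly_pos Finset.univ p' (fun k _ => hp'mem k)
      (by rw [hcard] at hk; simpa using hk))
    (fun k => coeff_prod_bernoulliPoly_mul_le Finset.univ p'
      (fun k _ => Set.Ioo_subset_Icc_self (hp'mem k)) (Nat.le_succ k) 1) hR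
  rwa [hcard] at hmain

/-- On the open cube all relevant coefficients are positive, so their logarithms behave; both sides
being continuous, the inequality passes to the closed cube. -/
lemma coeffEntropy_le_averagePair {n : ℕ} {p : Fin n → ℝ}
    (hp : ∀ k, p k ∈ Set.Icc (0 : ℝ) 1) {i j : Fin n} (hij : i ≠ j) :
    coeffEntropy n (∏ k, bernoulliPoly (p k)) ≤
      coeffEntropy n (∏ k, bernoulliPoly (averagePair p i j k)) := by
  have hcont : Continuous fun p : Fin n → ℝ => averagePair p i j := by
    have h : Continuous fun p : Fin n → ℝ => (p i + p j) / 2 := by fun_prop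
    exact (continuous_id.update i h).update j h
  have hclosed : IsClosed {p : Fin n → ℝ | coeffEntropy n (∏ k, bernoulliPoly (p k)) ≤
      coeffEntropy n (∏ k, bernoulliPoly (averagePair p i j k))} :=
    isClosed_le (continuous_coeffEntropy_prod n Finset.univ)
      ((continuous_coeffEntropy_prod n Finset.univ).comp hcont)
  have hsub : Set.univ.pi (fun _ : Fin n => Set.Ioo (0 : ℝ) 1) ⊆
      {p : Fin n → ℝ | coeffEntropy n (∏ k, bernoulliPoly (p k)) ≤
        coeffEntropy n (∏ k, bernoulliPoly (averagePair p i j k))} :=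
    fun q hq => coeffEntropy_le_averagePair_of_mem_Ioo (fun k => hq k (Set.mem_univ k)) hij
  refine closure_minimal hsub hclosed ?_
  rw [closure_pi_set]
  intro k _
  rw [closure_Ioo zero_ne_one]
  exact hp k

lemma sum_sq_averagePair_lt {n : ℕ} (p : Fin n → ℝ) {i j : Fin n} (hij : i ≠ j)
    (hne : p i ≠ p j) : ∑ k, averagePair p i j k ^ 2 < ∑ k, p k ^ 2 := by
  have h : ∀ q : Fin n → ℝ, ∑ k, q k ^ 2
      = q i ^ 2 + q j ^ 2 + ∑ k ∈ ({i, j} : Finset (Fin n))ᶜ, q k ^ 2 := by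
    intro q
    rw [← Finset.sum_add_sum_compl {i, j}, Finset.sum_pair hij]
  rw [h, h p]
  have hrest : ∑ k ∈ ({i, j} : Finset (Fin n))ᶜ, averagePair p i j k ^ 2
      = ∑ k ∈ ({i, j} : Finset (Fin n))ᶜ, p k ^ 2 := by
    refine Finset.sum_congr rfl fun k hk => ?_
    simp only [Finset.mem_compl, Finset.mem_insert, Finset.mem_singleton, not_or] at hk
    simp [averagePair, hk.1, hk.2]
  have hi : averagePair p i j i = (p i + p j) / 2 := by simp [averagePair, hij]
  have hj : averagePair p i j j = (p i + p j) / 2 := by simp [averagePair]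
  rw [hrest, hi, hj]
  have : 0 < (p i - p j) ^ 2 := by
    have := sub_ne_zero.2 hne
    positivity
  nlinarith

/-- The entropy of a sum of independent Bernoulli variables is at most that of some binomial. -/
lemma exists_coeffEntropy_le_pow {n : ℕ} {p : Fin n → ℝ} (hp : ∀ k, p k ∈ Set.Icc (0 : ℝ) 1) :
    ∃ c ∈ Set.Icc (0 : ℝ) 1,
      coeffEntropy n (∏ k, bernoulliPoly (p k)) ≤ coeffEntropy n (bernoulliPoly c ^ n) := by
  set F : (Fin n → ℝ) → ℝ := fun p => coeffEntropy n (∏ k, bernoulliPoly (p k)) with hF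
  have hFc : Continuous F := continuous_coeffEntropy_prod n Finset.univ
  set K : Set (Fin n → ℝ) := Set.univ.pi fun _ => Set.Icc (0 : ℝ) 1 with hK
  have hKc : IsCompact K := isCompact_univ_pi fun _ => isCompact_Icc
  obtain ⟨q, hqK, hq⟩ := hKc.exists_isMaxOn ⟨p, fun k _ => hp k⟩ hFc.continuousOn
  -- Among the maximizers, take one with least sum of squares: averaging two unequal entries would
  -- keep it a maximizer and lower that sum.
  obtain ⟨r, ⟨hrK, hrq⟩, hr⟩ := (hKc.inter_right (isClosed_le (continuous_const (y := F q)) hFc)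
    ).exists_isMinOn ⟨q, hqK, le_refl (F q)⟩
    (f := fun p : Fin n → ℝ => ∑ k, p k ^ 2) (by fun_prop)
  have hrK' : ∀ k, r k ∈ Set.Icc (0 : ℝ) 1 := fun k => hrK k (Set.mem_univ k)
  have heq : ∀ i j, r i = r j := by
    intro i j
    by_contra hne
    have hij : i ≠ j := fun h => hne (congrArg r h)
    refine absurd (hr ⟨fun k _ => averagePair_mem (convex_Icc 0 1) hrK' i j k, ?_⟩)
      (not_le.2 (sum_sq_averagePair_lt r hij hne))
    exact le_trans hrq (coeffEntropy_le_averagePair hrK' hij)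
  have hpr : F p ≤ F r := (hq fun k _ => hp k).trans hrq
  -- With no parameters there is no `r 0`, and any `c` works.
  rcases n with _ | n
  · exact ⟨0, by simp, by simp⟩
  · refine ⟨r 0, hrK' 0, hpr.trans_eq ?_⟩
    simp [hF, heq _ 0]

/-! ### Binomial means and concavity of the binomial entropy -/

lemma coeff_bernoulliPoly_pow (x : ℝ) (n k : ℕ) :
    (bernoulliPoly x ^ n).coeff k = (n.choose k : ℝ) * x ^ k * (1 - x) ^ (n - k) := by
  have h : bernoulliPoly x = Polynomial.C x * Polynomial.X + Polynomial.C (1 - x) := by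
    simp only [bernoulliPoly, map_sub, map_one]; ring
  have h2 : bernoulliPoly x ^ n = ∑ m ∈ Finset.range (n + 1),
      Polynomial.C ((n.choose m : ℝ) * x ^ m * (1 - x) ^ (n - m)) * Polynomial.X ^ m := by
    rw [h, add_pow]
    refine Finset.sum_congr rfl fun m _ => ?_
    simp only [map_mul, map_pow, map_natCast]
    ring
  rw [h2, Polynomial.finsetSum_coeff]
  simp only [Polynomial.coeff_C_mul, Polynomial.coeff_X_pow, mul_ite, mul_one, mul_zero,
    Finset.sum_ite_eq, Finset.mem_range]
  split_ifs with hk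
  · rfl
  · rw [Nat.choose_eq_zero_of_lt (by omega)]; simp

/-- The mean of `g` under the binomial distribution with `n` trials and parameter `x`. -/
noncomputable def binomialMean (n : ℕ) (g : ℕ → ℝ) (x : ℝ) : ℝ :=
  ∑ k ∈ Finset.range (n + 1), (bernoulliPoly x ^ n).coeff k * g k

/-- Condition on the last trial: with probability `x` it raises the count by one. -/
lemma binomialMean_succ (n : ℕ) (g : ℕ → ℝ) (x : ℝ) :
    binomialMean (n + 1) g x =
      binomialMean n g x + x * binomialMean n (fun k => g (k + 1) - g k) x := by
  have hz : (bernoulliPoly x ^ n).coeff (n + 1) = 0 := by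
    simp [coeff_bernoulliPoly_pow]
  have h := sum_coeff_X_sub_one_mul (bernoulliPoly x ^ n) g hz
  have hb : bernoulliPoly x ^ (n + 1) = bernoulliPoly x ^ n
      + Polynomial.C x * ((Polynomial.X - 1) * bernoulliPoly x ^ n) := by
    rw [pow_succ, bernoulliPoly]; ring
  simp only [binomialMean, hb, Polynomial.coeff_add, Polynomial.coeff_C_mul, add_mul,
    Finset.sum_add_distrib, mul_assoc, ← Finset.mul_sum]
  rw [h, Finset.sum_range_succ _ (n + 1), hz, zero_mul, add_zero]

lemma binomialMean_mono {n : ℕ} {f g : ℕ → ℝ} {x : ℝ} (hx : x ∈ Set.Icc (0 : ℝ) 1)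
    (h : ∀ k ≤ n, f k ≤ g k) : binomialMean n f x ≤ binomialMean n g x := by
  refine Finset.sum_le_sum fun k hk => mul_le_mul_of_nonneg_left (h k ?_) ?_
  · rw [Finset.mem_range] at hk; omega
  · rw [coeff_bernoulliPoly_pow]
    have h0 := hx.1
    have h1 := sub_nonneg.2 hx.2
    positivity

lemma binomialMean_add (n : ℕ) (f g : ℕ → ℝ) (x : ℝ) :
    binomialMean n (fun k => f k + g k) x = binomialMean n f x + binomialMean n g x := by
  simp [binomialMean, mul_add, Finset.sum_add_distrib]

lemma binomialMean_neg (n : ℕ) (f : ℕ → ℝ) (x : ℝ) :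
    binomialMean n (fun k => -f k) x = -binomialMean n f x := by
  simp [binomialMean]

lemma binomialMean_reflect (n : ℕ) (g : ℕ → ℝ) (x : ℝ) :
    binomialMean n (fun k => g (n - k)) x = binomialMean n g (1 - x) := by
  unfold binomialMean
  rw [← Finset.sum_range_reflect]
  refine Finset.sum_congr rfl fun k hk => ?_
  have hk : k ≤ n := by rw [Finset.mem_range] at hk; omega
  rw [coeff_bernoulliPoly_pow, coeff_bernoulliPoly_pow, show n + 1 - 1 - k = n - k by omega,
    Nat.choose_symm hk, sub_sub_cancel]
  simp only [Nat.sub_sub_self hk]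
  ring

/-- Induction by the product rule, reassembled with `binomialMean_succ`. The truncated `n - 1` at `n
= 0` is harmless because of the factor `n`. -/
lemma hasDerivAt_binomialMean (n : ℕ) (g : ℕ → ℝ) (x : ℝ) :
    HasDerivAt (binomialMean n g) (n * binomialMean (n - 1) (fun k => g (k + 1) - g k) x) x := by
  induction n generalizing g with
  | zero =>
    have : binomialMean 0 g = fun _ => g 0 := by ext; simp [binomialMean]
    rw [this]
    simpa using hasDerivAt_const x (g 0)
  | succ n ih =>
    rw [funext (binomialMean_succ n g)]
    refine ((ih g).add ((hasDerivAt_id x).mul (ih fun k => g (k + 1) - g k))).congr_deriv ?_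
    rcases n with _ | n
    · simp
    · simp only [Nat.add_sub_cancel, id]
      rw [binomialMean_succ n (fun k => g (k + 1) - g k)]
      push_cast
      ring

/-- Since `(m + 1) (m choose k) / (k + 1) = (m + 1 choose k + 1)`, the left side times `x` is the
probability of at least one success in `m + 1` trials. -/
lemma mul_binomialMean_inv_succ_le (m : ℕ) {x : ℝ} (hx : x ∈ Set.Ioo (0 : ℝ) 1) :
    (m + 1) * binomialMean m (fun k => 1 / ((k : ℝ) + 1)) x ≤ 1 / x := by
  have h0 := hx.1
  have h1 := sub_pos.2 hx.2
  rw [le_div_iff₀ h0]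
  have hsum : ∑ k ∈ Finset.range (m + 2), ((m + 1).choose k : ℝ) * x ^ k * (1 - x) ^ (m + 1 - k)
      = 1 := by
    have h := add_pow x (1 - x) (m + 1)
    rw [add_sub_cancel, one_pow] at h
    exact (Finset.sum_congr rfl fun k _ => by ring).trans h.symm
  rw [Finset.sum_range_succ'] at hsum
  have heq : (m + 1) * binomialMean m (fun k => 1 / ((k : ℝ) + 1)) x * x
      = ∑ k ∈ Finset.range (m + 1),
        ((m + 1).choose (k + 1) : ℝ) * x ^ (k + 1) * (1 - x) ^ (m + 1 - (k + 1)) := by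
    unfold binomialMean
    rw [Finset.mul_sum, Finset.sum_mul]
    refine Finset.sum_congr rfl fun k _ => ?_
    have hc : ((m : ℝ) + 1) * m.choose k = (m + 1).choose (k + 1) * (k + 1) := by
      exact_mod_cast Nat.add_one_mul_choose_eq m k
    rw [coeff_bernoulliPoly_pow, Nat.add_sub_add_right]
    have hk : (k : ℝ) + 1 ≠ 0 := by positivity
    field_simp
    linear_combination x ^ (k + 1) * hc
  rw [heq]
  have : 0 ≤ ((m + 1).choose 0 : ℝ) * x ^ 0 * (1 - x) ^ (m + 1 - 0) := by positivity
  linarith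

lemma log_succ_sub_log_le {a : ℝ} (ha : 0 < a) : Real.log (a + 1) - Real.log a ≤ 1 / a := by
  rw [← Real.log_div (by positivity) ha.ne']
  refine (Real.log_le_sub_one_of_pos (by positivity)).trans_eq ?_
  field_simp
  ring

/-- With `j = m - k`, the ratios of consecutive binomial coefficients give the second difference
exactly: `log ((k + 1)/(k + 2)) + log ((j + 1)/(j + 2))`. -/
lemma neg_le_diff_log_choose {m k : ℕ} (hk : k ≤ m) :
    -(1 / ((k : ℝ) + 1) + 1 / (((m - k : ℕ) : ℝ) + 1)) ≤
      Real.log ((m + 2).choose (k + 2)) - Real.log ((m + 2).choose (k + 1))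
        - (Real.log ((m + 2).choose (k + 1)) - Real.log ((m + 2).choose k)) := by
  obtain ⟨j, rfl⟩ := Nat.exists_eq_add_of_le hk
  have hpos : ∀ i ≤ k + j + 2, (0 : ℝ) < (k + j + 2).choose i := fun i hi => by
    exact_mod_cast Nat.choose_pos hi
  have step : ∀ i ≤ k + j + 1,
      Real.log ((k + j + 2).choose (i + 1)) + Real.log ((i : ℝ) + 1) =
        Real.log ((k + j + 2).choose i) + Real.log ((k + j + 2 - i : ℕ) : ℝ) := by
    intro i hi
    have h1 := hpos i (by omega)
    have h2 := hpos (i + 1) (by omega)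
    have h3 : (0 : ℝ) < ((k + j + 2 - i : ℕ) : ℝ) := by
      exact_mod_cast (by omega : 0 < k + j + 2 - i)
    rw [← Real.log_mul h2.ne' (by positivity), ← Real.log_mul h1.ne' h3.ne']
    congr 1
    exact_mod_cast Nat.choose_succ_right_eq (k + j + 2) i
  have s0 := step k (by omega)
  have s1 := step (k + 1) (by omega)
  rw [show k + j + 2 - k = j + 2 by omega] at s0
  rw [show k + j + 2 - (k + 1) = j + 1 by omega] at s1
  have l0 := log_succ_sub_log_le (a := (k : ℝ) + 1) (by positivity)
  have l1 := log_succ_sub_log_le (a := (j : ℝ) + 1) (by positivity)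
  rw [show k + j - k = j by omega]
  push_cast at s0 s1
  rw [show (j : ℝ) + 2 = j + 1 + 1 by ring] at s0
  rw [show k + 1 + 1 = k + 2 by ring] at s1
  linarith

lemma coeffEntropy_pow_eq (n : ℕ) {x : ℝ} (hx : x ∈ Set.Ioo (0 : ℝ) 1) :
    coeffEntropy n (bernoulliPoly x ^ n) =
      n * Real.binEntropy x - binomialMean n (fun k => Real.log (n.choose k)) x := by
  have h0 := hx.1
  have h1 := sub_pos.2 hx.2
  have hone : ∀ m, binomialMean m (fun _ => 1) x = 1 := by
    intro m
    induction m with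
    | zero => simp [binomialMean]
    | succ m ih => rw [binomialMean_succ, ih]; simp [binomialMean]
  have hid : ∀ m, binomialMean m (fun k => (k : ℝ)) x = m * x := by
    intro m
    induction m with
    | zero => simp [binomialMean]
    | succ m ih => rw [binomialMean_succ, ih]; simp [hone]; ring
  have hterm : ∀ k ∈ Finset.range (n + 1), Real.negMulLog ((bernoulliPoly x ^ n).coeff k) =
      (bernoulliPoly x ^ n).coeff k * (k : ℝ) * (Real.log (1 - x) - Real.log x)
        - (bernoulliPoly x ^ n).coeff k * 1 * (n * Real.log (1 - x))
        - (bernoulliPoly x ^ n).coeff k * Real.log (n.choose k) := by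
    intro k hk
    have hk : k ≤ n := by rw [Finset.mem_range] at hk; omega
    have hc : (0 : ℝ) < n.choose k := by exact_mod_cast Nat.choose_pos hk
    rw [Real.negMulLog, coeff_bernoulliPoly_pow, Real.log_mul (by positivity) (by positivity),
      Real.log_mul (by positivity) (by positivity), Real.log_pow, Real.log_pow, Nat.cast_sub hk]
    ring
  have hone := hone n
  have hid := hid n
  unfold binomialMean at hone hid
  rw [coeffEntropy, Finset.sum_congr rfl hterm, Finset.sum_sub_distrib, Finset.sum_sub_distrib,
    ← Finset.sum_mul, ← Finset.sum_mul, hone, hid, Real.binEntropy_eq_negMulLog_add_negMulLog_one_sub,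
    binomialMean]
  simp only [Real.negMulLog]
  ring

/-- The binary entropy contributes `-n(1/x + 1/(1 - x))` to the second derivative. For `n = m + 2`,
the term in `log (n choose k)` contributes at most `n(m + 1) E[1/(K + 1) + 1/(m - K + 1)]`, `K`
binomial with `m` trials, and `mul_binomialMean_inv_succ_le` at `x` and `1 - x` shows that this
cannot exceed the first in size. -/
lemma concaveOn_coeffEntropy_pow (n : ℕ) :
    ConcaveOn ℝ (Set.Ioo (0 : ℝ) 1) fun x => coeffEntropy n (bernoulliPoly x ^ n) := by
  set g : ℕ → ℝ := fun k => Real.log (n.choose k) with hg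
  set D : (ℕ → ℝ) → ℕ → ℝ := fun f k => f (k + 1) - f k with hD
  refine ConcaveOn.congr (f := fun x => n * Real.binEntropy x - binomialMean n g x) ?_
    fun x hx => (coeffEntropy_pow_eq n hx).symm
  have hd1 : ∀ x ∈ Set.Ioo (0 : ℝ) 1,
      HasDerivAt (fun x => n * Real.binEntropy x - binomialMean n g x)
        (n * (Real.log (1 - x) - Real.log x) - n * binomialMean (n - 1) (D g) x) x := fun x hx =>
    ((Real.hasDerivAt_binEntropy hx.1.ne' hx.2.ne).const_mul _).sub (hasDerivAt_binomialMean n g x)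
  have hd2 : ∀ x ∈ Set.Ioo (0 : ℝ) 1,
      HasDerivAt (fun x => n * (Real.log (1 - x) - Real.log x) - n * binomialMean (n - 1) (D g) x)
        (n * (-1 / (1 - x) - 1 / x)
          - n * ((n - 1 : ℕ) * binomialMean (n - 1 - 1) (D (D g)) x)) x := fun x hx =>
    (((((hasDerivAt_id x).const_sub 1).log (sub_pos.2 hx.2).ne').sub
      ((hasDerivAt_id x).log hx.1.ne')).const_mul _).sub
      ((hasDerivAt_binomialMean (n - 1) (D g) x).const_mul _)
  refine concaveOn_of_hasDerivWithinAt2_nonpos (convex_Ioo 0 1)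
    (fun x hx => (hd1 x hx).continuousAt.continuousWithinAt)
    (fun x hx => (hd1 x (interior_subset hx)).hasDerivWithinAt)
    (fun x hx => (hd2 x (interior_subset hx)).hasDerivWithinAt) ?_
  intro x hx
  have hx : x ∈ Set.Ioo (0 : ℝ) 1 := interior_subset hx
  have h0 := hx.1
  have h1 := sub_pos.2 hx.2
  have hpos : 0 ≤ 1 / (1 - x) + 1 / x := by positivity
  rw [← mul_sub]
  refine mul_nonpos_of_nonneg_of_nonpos (Nat.cast_nonneg n) ?_
  -- For `n ≤ 1` the factor `n - 1` removes the binomial mean.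
  rcases n with _ | _ | m
  · simp only [Nat.zero_sub, Nat.cast_zero, zero_mul, neg_div]; linarith
  · simp only [zero_add, Nat.sub_self, Nat.cast_zero, zero_mul, neg_div]; linarith
  · have hle : -(binomialMean m (fun k => 1 / ((k : ℝ) + 1)) x
        + binomialMean m (fun k => 1 / (((m - k : ℕ) : ℝ) + 1)) x) ≤
        binomialMean m (D (D g)) x := by
      rw [← binomialMean_add, ← binomialMean_neg]
      exact binomialMean_mono (Set.Ioo_subset_Icc_self hx) fun k hk => neg_le_diff_log_choose hk
    have hb1 := mul_binomialMean_inv_succ_le m hx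
    have hb2 := mul_binomialMean_inv_succ_le m (x := 1 - x) ⟨h1, by linarith⟩
    rw [← binomialMean_reflect] at hb2
    have h := mul_le_mul_of_nonneg_left hle (by positivity : (0 : ℝ) ≤ m + 1)
    rw [show m + 1 + 1 - 1 - 1 = m by omega, show m + 1 + 1 - 1 = m + 1 by omega]
    push_cast
    rw [neg_div]
    linarith

lemma coeffEntropy_pow_one_sub (n : ℕ) (x : ℝ) :
    coeffEntropy n (bernoulliPoly (1 - x) ^ n) = coeffEntropy n (bernoulliPoly x ^ n) := by
  unfold coeffEntropy
  rw [← Finset.sum_range_reflect]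
  refine Finset.sum_congr rfl fun k hk => ?_
  have hk : k ≤ n := by rw [Finset.mem_range] at hk; omega
  rw [coeff_bernoulliPoly_pow, coeff_bernoulliPoly_pow, show n + 1 - 1 - k = n - k by omega,
    Nat.sub_sub_self hk, Nat.choose_symm hk, sub_sub_cancel]
  congr 1
  ring

/-- The binomial entropy is largest for a fair coin. -/
lemma coeffEntropy_pow_le_half (n : ℕ) {x : ℝ} (hx : x ∈ Set.Icc (0 : ℝ) 1) :
    coeffEntropy n (bernoulliPoly x ^ n) ≤ coeffEntropy n (bernoulliPoly (1 / 2) ^ n) := by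
  have hcont : Continuous fun x : ℝ => coeffEntropy n (bernoulliPoly x ^ n) := by
    unfold coeffEntropy
    simp_rw [coeff_bernoulliPoly_pow]
    exact continuous_finsetSum _ fun k _ => Real.continuous_negMulLog.comp (by fun_prop)
  rw [← closure_Ioo zero_ne_one] at hx
  refine closure_minimal (s := Set.Ioo (0 : ℝ) 1)
    (t := {x | coeffEntropy n (bernoulliPoly x ^ n) ≤ coeffEntropy n (bernoulliPoly (1 / 2) ^ n)})
    ?_ (isClosed_le hcont continuous_const) hx
  intro y hy
  have hy' : 1 - y ∈ Set.Ioo (0 : ℝ) 1 := ⟨by linarith [hy.2], by linarith [hy.1]⟩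
  -- `1/2` is the midpoint of `y` and `1 - y`, where the entropies agree.
  have h := (concaveOn_coeffEntropy_pow n).2 hy hy' (by norm_num : (0 : ℝ) ≤ 1 / 2)
    (by norm_num : (0 : ℝ) ≤ 1 / 2) (by norm_num)
  simp only [smul_eq_mul, coeffEntropy_pow_one_sub] at h
  rw [show 1 / 2 * y + 1 / 2 * (1 - y) = 1 / 2 by ring] at h
  rw [Set.mem_ofPred_eq]
  linarith

/-! ### From random variables to polynomials -/

section Law

variable {Ω : Type*} [MeasurableSpace Ω] {μ : Measure Ω}

lemma measureReal_inter_preimage_eq_mul {Y Z : Ω → ℕ} (h : IndepFun Y Z μ) (a b : ℕ) :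
    μ.real (Y ⁻¹' {a} ∩ Z ⁻¹' {b}) = μ.real (Y ⁻¹' {a}) * μ.real (Z ⁻¹' {b}) := by
  simp only [Measure.real, h.measure_inter_preimage_eq_mul {a} {b} (measurableSet_singleton a)
    (measurableSet_singleton b), ENNReal.toReal_mul]

variable [IsProbabilityMeasure μ]

/-- The two prescribed masses exhaust the total mass, so other natural values occur only on a null
set. -/
lemma ae_eq_zero_or_one {x : ℝ} {Z : Ω → ℕ} (hZ : Measurable Z)
    (h1 : μ.real (Z ⁻¹' {1}) = x) (h0 : μ.real (Z ⁻¹' {0}) = 1 - x) :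
    ∀ᵐ ω ∂μ, Z ω = 0 ∨ Z ω = 1 := by
  have hm : MeasurableSet (Z ⁻¹' {0, 1}) := hZ (Set.toFinite _).measurableSet
  have hU : Z ⁻¹' {0, 1} = Z ⁻¹' {0} ∪ Z ⁻¹' {1} := by
    rw [← Set.preimage_union]; rfl
  have h : μ.real (Z ⁻¹' {0, 1}) = 1 := by
    rw [hU, measureReal_union (Disjoint.preimage _ (by simp)) (hZ (measurableSet_singleton 1)),
      h0, h1]
    ring
  have h' : μ (Z ⁻¹' {0, 1}) = 1 := by
    rwa [Measure.real, ENNReal.toReal_eq_one_iff] at h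
  exact (mem_ae_iff_prob_eq_one hm).2 h'

lemma measureReal_add_preimage {x : ℝ} {P : Polynomial ℝ} {Y Z : Ω → ℕ} (hY : Measurable Y)
    (hZ : Measurable Z) (h : IndepFun Y Z μ) (h1 : μ.real (Z ⁻¹' {1}) = x)
    (h0 : μ.real (Z ⁻¹' {0}) = 1 - x) (hP : ∀ k, μ.real (Y ⁻¹' {k}) = P.coeff k) (k : ℕ) :
    μ.real ((Y + Z) ⁻¹' {k}) = (P * bernoulliPoly x).coeff k := by
  have hae := ae_eq_zero_or_one hZ h1 h0
  cases k with
  | zero =>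
    rw [coeff_mul_bernoulliPoly_zero, ← hP, ← h0, mul_comm, ← measureReal_inter_preimage_eq_mul h]
    congr 1
    ext ω
    simp
  | succ k =>
    rw [coeff_mul_bernoulliPoly_succ, ← hP, ← hP, ← h0]
    rw [← h1, mul_comm, mul_comm (μ.real (Z ⁻¹' {1})), ← measureReal_inter_preimage_eq_mul h,
      ← measureReal_inter_preimage_eq_mul h, ← measureReal_union]
    · refine measureReal_congr ?_
      filter_upwards [hae] with ω hω
      refine propext ?_
      change Y ω + Z ω = k + 1 ↔ (Y ω = k + 1 ∧ Z ω = 0) ∨ (Y ω = k ∧ Z ω = 1)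
      omega
    · rw [Set.disjoint_left]
      rintro ω ⟨-, hω⟩ ⟨-, hω'⟩
      simp only [Set.mem_preimage, Set.mem_singleton_iff] at hω hω'
      omega
    · exact (hY (measurableSet_singleton _)).inter (hZ (measurableSet_singleton _))

lemma IsIndepBernoulli.measureReal_sum_preimage {n : ℕ} {X : Fin n → Ω → ℕ} {p : Fin n → ℝ}
    (h : IsIndepBernoulli μ X p) (s : Finset (Fin n)) (k : ℕ) :
    μ.real ((∑ i ∈ s, X i) ⁻¹' {k}) = (∏ i ∈ s, bernoulliPoly (p i)).coeff k := by
  induction s using Finset.induction_on generalizing k with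
  | empty =>
    rw [Finset.sum_empty, Finset.prod_empty, Polynomial.coeff_one]
    split_ifs with hk
    · subst hk
      rw [show (0 : Ω → ℕ) ⁻¹' {0} = Set.univ by ext; simp]
      simp
    · rw [show (0 : Ω → ℕ) ⁻¹' {k} = ∅ by ext; simp [eq_comm, hk]]
      simp
  | insert a s ha ih =>
    rw [Finset.sum_insert ha, Finset.prod_insert ha, add_comm, mul_comm]
    refine measureReal_add_preimage ?_ (h.measurable a) (h.indep.indepFun_finsetSum_of_notMem h.measurable ha) (h.prob_one a)
      (h.prob_zero a) ih k
    rw [Finset.sum_fn]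
    exact Finset.measurable_sum s fun i _ => h.measurable i

lemma IsIndepBernoulli.shannonEntropy_sum {n : ℕ} {X : Fin n → Ω → ℕ} {p : Fin n → ℝ}
    (h : IsIndepBernoulli μ X p) :
    shannonEntropy μ (fun ω => ∑ i, X i ω) =
      coeffEntropy n (∏ i, bernoulliPoly (p i)) / Real.log 2 := by
  have hlaw : ∀ k, μ.real ((fun ω => ∑ i, X i ω) ⁻¹' {k}) =
      (∏ i, bernoulliPoly (p i)).coeff k := by
    intro k
    rw [← h.measureReal_sum_preimage]
    congr 2
    ext ω
    simp
  simp only [shannonEntropy, hlaw]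
  rw [tsum_eq_sum (s := Finset.range (n + 1)), ← Finset.sum_neg_distrib, coeffEntropy,
    Finset.sum_div]
  · exact Finset.sum_congr rfl fun k _ => by simp only [Real.negMulLog, Real.logb]; ring
  · intro k hk
    rw [Finset.mem_range, not_lt] at hk
    rw [coeff_prod_bernoulliPoly_eq_zero _ _ (by simpa using hk), zero_mul]

end Law

/-- Coordinates under a product of two-point measures; needed for the maximum to be attained. -/
lemma exists_isIndepBernoulli {n : ℕ} {p : Fin n → ℝ} (hp : ∀ i, p i ∈ Set.Icc (0 : ℝ) 1) :
    ∃ (Ω : Type) (_ : MeasurableSpace Ω) (μ : Measure Ω) (_ : IsProbabilityMeasure μ)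
      (X : Fin n → Ω → ℕ), IsIndepBernoulli μ X p := by
  let ν : Fin n → Measure ℕ := fun i =>
    ENNReal.ofReal (1 - p i) • Measure.dirac 0 + ENNReal.ofReal (p i) • Measure.dirac 1
  have hν : ∀ i, IsProbabilityMeasure (ν i) := fun i => ⟨by
    simp only [ν, Measure.add_apply, Measure.smul_apply, measure_univ, smul_eq_mul, mul_one]
    rw [← ENNReal.ofReal_add (sub_nonneg.2 (hp i).2) (hp i).1, sub_add_cancel, ENNReal.ofReal_one]⟩
  have hmap : ∀ (i : Fin n) (k : ℕ),
      (Measure.pi ν).real ((fun ω : Fin n → ℕ => ω i) ⁻¹' {k}) = (ν i).real {k} := by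
    intro i k
    rw [Measure.real, Measure.real, ← (measurePreserving_eval ν i).map_eq,
      Measure.map_apply (measurable_pi_apply i) (measurableSet_singleton k)]
  refine ⟨Fin n → ℕ, inferInstance, Measure.pi ν, inferInstance, fun i ω => ω i,
    fun i => measurable_pi_apply i, ?_, fun i => ?_, fun i => ?_⟩
  · exact iIndepFun_pi (X := fun _ k => k) fun i => aemeasurable_id
  · rw [hmap]
    simp [ν, Measure.real, ENNReal.toReal_ofReal (hp i).1]
  · rw [hmap]
    simp [ν, Measure.real, ENNReal.toReal_ofReal (sub_nonneg.2 (hp i).2)]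

lemma binomialEntropy_eq (n : ℕ) (p : ℝ) :
    binomialEntropy n p = coeffEntropy n (bernoulliPoly p ^ n) / Real.log 2 := by
  rw [binomialEntropy, coeffEntropy, Finset.sum_div, ← Finset.sum_neg_distrib]
  refine Finset.sum_congr rfl fun k _ => ?_
  rw [coeff_bernoulliPoly_pow, Real.negMulLog, Real.logb]
  ring

lemma IsIndepBernoulli.shannonEntropy_sum_le {n : ℕ} {Ω : Type*} [MeasurableSpace Ω]
    {μ : Measure Ω} [IsProbabilityMeasure μ] {X : Fin n → Ω → ℕ} {p : Fin n → ℝ}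
    (hp : ∀ i, p i ∈ Set.Icc (0 : ℝ) 1) (h : IsIndepBernoulli μ X p) :
    shannonEntropy μ (fun ω => ∑ i, X i ω) ≤ binomialEntropy n (1 / 2) := by
  obtain ⟨c, hc, hle⟩ := exists_coeffEntropy_le_pow hp
  rw [h.shannonEntropy_sum, binomialEntropy_eq]
  exact div_le_div_of_nonneg_right (hle.trans (coeffEntropy_pow_le_half n hc))
    (Real.log_nonneg one_le_two)

lemma IsIndepBernoulli.shannonEntropy_sum_eq {n : ℕ} {Ω : Type*} [MeasurableSpace Ω]
    {μ : Measure Ω} [IsProbabilityMeasure μ] {X : Fin n → Ω → ℕ} {p : Fin n → ℝ}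
    (h : IsIndepBernoulli μ X p) {c : ℝ} (hp : ∀ i, p i = c) :
    shannonEntropy μ (fun ω => ∑ i, X i ω) = binomialEntropy n c := by
  rw [h.shannonEntropy_sum, binomialEntropy_eq]
  simp [hp]

theorem theorem2 (n : ℕ) :
    (∀ p : Fin n → ℝ, (∀ i, p i ∈ Set.Icc (0 : ℝ) 1) →
      ∀ (Ω : Type*) [MeasurableSpace Ω] (μ : Measure Ω) [IsProbabilityMeasure μ]
        (X : Fin n → Ω → ℕ), IsIndepBernoulli μ X p →
        shannonEntropy μ (fun ω => ∑ i, X i ω) ≤ binomialEntropy n (1 / 2) ∧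
        ((∀ i, p i = 1 / 2) →
          shannonEntropy μ (fun ω => ∑ i, X i ω) = binomialEntropy n (1 / 2))) ∧
    IsGreatest
      {h : ℝ | ∃ p : Fin n → ℝ, (∀ i, p i ∈ Set.Icc (0 : ℝ) 1) ∧
        ∃ (Ω : Type) (_ : MeasurableSpace Ω) (μ : Measure Ω) (_ : IsProbabilityMeasure μ)
          (X : Fin n → Ω → ℕ), IsIndepBernoulli μ X p ∧
          h = shannonEntropy μ (fun ω => ∑ i, X i ω)}
      (binomialEntropy n (1 / 2)) := by
  refine ⟨fun p hp Ω _ μ _ X h => ⟨h.shannonEntropy_sum_le hp, h.shannonEntropy_sum_eq⟩, ?_, ?_⟩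
  · have hp : ∀ i : Fin n, (fun _ => 1 / 2 : Fin n → ℝ) i ∈ Set.Icc (0 : ℝ) 1 :=
      fun _ => ⟨by norm_num, by norm_num⟩
    obtain ⟨Ω, hΩ, μ, hμ, X, h⟩ := exists_isIndepBernoulli hp
    exact ⟨_, hp, Ω, hΩ, μ, hμ, X, h, (h.shannonEntropy_sum_eq fun _ => rfl).symm⟩
  · rintro _ ⟨p, hp, Ω, hΩ, μ, hμ, X, h, rfl⟩
    exact h.shannonEntropy_sum_le hp
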